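/- Let $A=(0,1)\times S^1$ be the open annulus, let $m_2:S^1\to S^1$, $m_2(z)=z^2$, and let $c=(0,1)\times\{1\}\subset A$. Identify $H_1(A)$ and $H_1(S^1)$ with $\mathbb Z$, the loop $t\mapsto(1/2,e^{2\pi it})$ and the loop $t\mapsto e^{2\pi i t}$ being the generators. Write $c\wedge\beta$ for the algebraic intersection number of $c$ with an arc $\beta:[0,1]\to A$ which is a loop or whose endpoints are not on $c$, with the sign for which $c\wedge\beta=1$ for $\beta(t)=(1/2,e^{2\pi it})$. For a loop $\alpha$ let $j\alpha$ be the concatenation of $\alpha$ with itself $j$ times; an $f^n$-lift of $j\alpha$ is an arc $\beta$ in $A$ with $f^n\circ\beta=j\alpha$. A continuous map $f:A\to A$ is semiconjugate to $m_2$ if there is a continuous $h:A\to S^1$ with $hf=m_2h$ and $h_*=\mathrm{id}:H_1(A)\to H_1(S^1)$. Consider for $f$ the condition (*) for each compact $K\subset A$ there is a number $C_K$ such that, for every simple closed curve $\alpha\subset A$, every $n\ge 1$ and every $j\in\{1,\dots,2^{n-1}\}$, any $f^n$-lift $\beta$ of $j\alpha$ with endpoints in $K$ (and for which $c\wedge\beta$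 is defined) satisfies $|c\wedge\beta|\le C_K$. Let $(a_n)_{n\in\mathbb Z}$ be any strictly increasing sequence in $(0,1)$ with $a_n\to0$ as $n\to-\infty$ and $a_n\to1$ as $n\to+\infty$, and let $A_n=[a_n,a_{n+1}]\times S^1$. Then there is a covering map $f:A\to A$ of degree $2$ (every point has exactly two preimages, and $f_*$ is multiplication by $2$ on $H_1(A)$) such that: 1. $f^{-1}(A_{n+1})=A_n$ and $f(a_n,z)=(a_{n+1},z^2)$ for all $n\in\mathbb Z$ and $z\in S^1$; and, for $n\le-1$, $f(x,z)=(\ell_n(x),z^2)$ on $A_n$, where $\ell_n$ is the increasing affine map of $[a_n,a_{n+1}]$ onto $[a_{n+1},a_{n+2}]$; 2. for every $n\ge1$ there are a simple closed curve $\alpha$ in $A_n$, an integer $j\in\{1,\dots,2^{n-1}\}$ and an $f^n$-lift $\beta$ of $j\alpha$ contained in $A_0$ for which $c\wedge\beta$ is defined and $|c\wedge\beta|>n-1$; 3. $f$ does not satisfy (*); 4. $f$ is not semiconjugate to $m_2$. -/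

import Mathlib

open Set Filter Topology

noncomputable section

namespace AnnulusCovering

/-- The open annulus `A = (0,1) × S¹`. -/
abbrev Annulus : Type := Ioo (0 : ℝ) 1 × Circle

/-- The projection of the annulus onto its `S¹` factor. -/
def proj : C(Annulus, Circle) := ⟨Prod.snd, continuous_snd⟩

/-- The map `m_d : S¹ → S¹`, `m_d z = z ^ d`. -/
def powerMap (d : ℕ) (z : Circle) : Circle := z ^ d

/-- `θ` is a continuous determination of the angle of `γ`, in turns: it is a lift of `γ` through
the universal covering `x ↦ e^{2πix}` of the circle. -/
def IsAngle (θ : C(unitInterval, ℝ)) (γ : C(unitInterval, Circle)) : Prop :=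
  ∀ t, Circle.exp (2 * Real.pi * θ t) = γ t

theorem exists_isAngle (γ : C(unitInterval, Circle)) : ∃ θ, IsAngle θ γ := by
  obtain ⟨Γ, hΓ, -⟩ := Circle.isCoveringMap_exp.exists_path_lifts γ (Complex.arg (γ 0))
    (Circle.exp_arg _).symm
  refine ⟨⟨fun t => Γ t / (2 * Real.pi), by fun_prop⟩, fun t => ?_⟩
  have h2 : (2 * Real.pi) ≠ 0 := by positivity
  have := congrFun hΓ t
  simpa [mul_div_cancel₀ _ h2, mul_div_assoc', mul_comm] using this

/-- Two angle determinations of the same path differ by a constant integer. -/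
theorem IsAngle.exists_int {θ θ' : C(unitInterval, ℝ)} {γ : C(unitInterval, Circle)}
    (h : IsAngle θ γ) (h' : IsAngle θ' γ) : ∃ m : ℤ, ∀ t, θ' t = θ t + m := by
  obtain ⟨m, hm⟩ := Circle.exp_eq_exp.1 ((h' 0).trans (h 0).symm)
  have hpi : (2 * Real.pi) ≠ 0 := by positivity
  have h0 : θ' 0 = θ 0 + m := by
    apply mul_left_cancel₀ hpi
    rw [hm]; ring
  refine ⟨m, fun t => ?_⟩
  have key : (fun t => 2 * Real.pi * θ' t) = fun t => 2 * Real.pi * (θ t + m) := by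
    refine Circle.isCoveringMap_exp.eq_of_comp_eq (by fun_prop) (by fun_prop) ?_ 0 (by rw [h0])
    funext s
    refine (h' s).trans ((h s).symm.trans ?_)
    exact Circle.exp_eq_exp.2 ⟨-m, by push_cast; ring⟩
  exact mul_left_cancel₀ hpi (congrFun key t)

/-- A chosen angle determination; nothing below depends on the choice. -/
def angle (γ : C(unitInterval, Circle)) : C(unitInterval, ℝ) := (exists_isAngle γ).choose

theorem isAngle_angle (γ : C(unitInterval, Circle)) : IsAngle (angle γ) γ :=
  (exists_isAngle γ).choose_spec

/-- A loop `ℝ/ℤ → X`, seen as a closed path. -/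
def loopPath {X : Type*} [TopologicalSpace X] (γ : C(UnitAddCircle, X)) : C(unitInterval, X) :=
  ⟨fun t => γ ((t : ℝ) : UnitAddCircle),
    γ.continuous.comp ((AddCircle.continuous_mk' 1).comp continuous_subtype_val)⟩

/-- The degree of a loop in `S¹`, that is, its class in `H₁(S¹) = ℤ`: the number of turns
`θ 1 - θ 0` (an integer, see `loopDegree_eq`). -/
def loopDegree (γ : C(UnitAddCircle, Circle)) : ℤ :=
  ⌊angle (loopPath γ) 1 - angle (loopPath γ) 0⌋

theorem loopDegree_eq (γ : C(UnitAddCircle, Circle)) {θ : C(unitInterval, ℝ)}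
    (h : IsAngle θ (loopPath γ)) : (loopDegree γ : ℝ) = θ 1 - θ 0 := by
  have e := isAngle_angle (loopPath γ)
  obtain ⟨m, hm⟩ := h.exists_int e
  have hl : loopPath γ 1 = loopPath γ 0 := by
    have : ((1 : ℝ) : UnitAddCircle) = 0 := AddCircle.coe_period 1
    simp [loopPath, this]
  obtain ⟨k, hk⟩ := Circle.exp_eq_exp.1 (((h 1).trans hl).trans (h 0).symm)
  have hpi : (2 * Real.pi) ≠ 0 := by positivity
  have h1 : θ 1 = θ 0 + k := by
    apply mul_left_cancel₀ hpi
    rw [hk]; ring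
  have : angle (loopPath γ) 1 - angle (loopPath γ) 0 = (k : ℝ) := by rw [hm, hm, h1]; ring
  rw [loopDegree, this, Int.floor_intCast, h1]; ring

/-- The class in `H₁(A) = ℤ` of a loop in the annulus (generator: the loop `t ↦ (1/2, e^{2πit})`). -/
def homologyClass (γ : C(UnitAddCircle, Annulus)) : ℤ := loopDegree (proj.comp γ)

/-- `f : A → A` has degree `d`: the induced map on `H₁(A) = ℤ` is multiplication by `d`. -/
def HasDegree (f : C(Annulus, Annulus)) (d : ℤ) : Prop :=
  ∀ γ : C(UnitAddCircle, Annulus), homologyClass (f.comp γ) = d * homologyClass γ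

/-- `f` is semiconjugate to `m_d`: there is a continuous `h : A → S¹` with `h f = m_d h` that
induces the identity `H₁(A) = ℤ → ℤ = H₁(S¹)`. -/
def IsSemiconjugate (f : C(Annulus, Annulus)) (d : ℕ) : Prop :=
  ∃ h : C(Annulus, Circle),
    (∀ γ : C(UnitAddCircle, Annulus), loopDegree (h.comp γ) = homologyClass γ) ∧
    Function.Semiconj h f (powerMap d)

/-- The arc `c = (0,1) × {1}`, joining one end of the annulus to the other. -/
def transversal : Set Annulus := {p | p.2 = 1}

/-- The intersection number with `c` is defined for the arcs `β` whose endpoints are not on `c`,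
and for loops. -/
def CrossingDefined (β : C(unitInterval, Annulus)) : Prop :=
  (β 0 ∉ transversal ∧ β 1 ∉ transversal) ∨ β 0 = β 1

/-- The algebraic intersection number `c ∧ β`. The lifts of `c` to the universal covering are the
lines of integral angle `k`; a lift of `β` whose angle goes from `x` to `y` crosses the line `k`
algebraically `+1` times if `x < k < y`, `-1` times if `y < k < x`, and `0` times
otherwise, so that the sum over `k` is `⌊y⌋ - ⌊x⌋` for nonintegral `x`, `y`; for a loop it is
`y - x`, the homology class. The sign is such that `t ↦ (1/2, e^{2πit})` gives `1`. -/
def crossing (β : C(unitInterval, Annulus)) : ℤ :=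
  ⌊angle (proj.comp β) 1⌋ - ⌊angle (proj.comp β) 0⌋

theorem crossing_eq (β : C(unitInterval, Annulus)) {θ : C(unitInterval, ℝ)}
    (h : IsAngle θ (proj.comp β)) : crossing β = ⌊θ 1⌋ - ⌊θ 0⌋ := by
  obtain ⟨m, hm⟩ := h.exists_int (isAngle_angle (proj.comp β))
  rw [crossing, hm, hm, Int.floor_add_intCast, Int.floor_add_intCast]; ring

/-- `β` is an `f^n`-lift of `jα`, the loop `α` run through `j` times. -/
def IsIterateLift (f : C(Annulus, Annulus)) (n j : ℕ) (α : C(UnitAddCircle, Annulus))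
    (β : C(unitInterval, Annulus)) : Prop :=
  ∀ t : unitInterval, f^[n] (β t) = α ((j * (t : ℝ) : ℝ) : UnitAddCircle)

/-- Condition (*): for each compact `K ⊆ A` there is `C` such that, for every simple closed curve
`α`, every `n ≥ 1` and every `1 ≤ j ≤ d^(n-1)`, any `f^n`-lift `β` of `jα` with endpoints in `K`
satisfies `|β ∧ c| ≤ C` (as soon as this number is defined). -/
def ConditionStar (f : C(Annulus, Annulus)) (d : ℕ) : Prop :=
  ∀ K : Set Annulus, IsCompact K → ∃ C : ℝ,
    ∀ α : C(UnitAddCircle, Annulus), Function.Injective α →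
    ∀ n : ℕ, 1 ≤ n → ∀ j : ℕ, 1 ≤ j → j ≤ d ^ (n - 1) →
    ∀ β : C(unitInterval, Annulus), IsIterateLift f n j α β → β 0 ∈ K → β 1 ∈ K →
      CrossingDefined β → |(crossing β : ℝ)| ≤ C

/-- The closed annulus `A_n = [a_n, a_{n+1}] × S¹`. -/
def subAnnulus (a : ℤ → Ioo (0 : ℝ) 1) (n : ℤ) : Set Annulus :=
  {p | a n ≤ p.1 ∧ p.1 ≤ a (n + 1)}

end AnnulusCovering

end

open Set Filter Topology

noncomputable section

namespace AnnulusCovering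

/-! In the chart `ℝ × S¹`, where `A_n` is `[n, n + 1] × S¹`, the map is `(x, z) ↦ (x + 1, z²)`
precomposed with a homeomorphism supported in disjoint bands, one inside `[m, m + 1]` for each
natural `m`. That homeomorphism first rotates each circle by `twist x` and then displaces points
radially by `push x` times the height `Im w`.

The fractional parts of the bands are disjoint, so a point of `A_0` lying below the `m`-th band
meets no band during its first `m` steps, and there the iterate is `(x, z) ↦ (x + m, z ^ 2 ^ m)`.
Over half a turn of the mid-circle of the `m`-th band, the inverse radial shear gives an arc that
crosses the middle third; along it `twist` varies by about `(m + 1) 2 ^ m`. Undoing `twist` makes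
the arc wind that often, and pulling it back to `A_0` divides the winding by `2 ^ m`. The result is
a lift, under `m + 1` iterates, of a circle run through once, which crosses `c` exactly `m + 1`
times (`exists_band_lift`, `exists_lift_crossing`). As `A_0` is compact, (*) fails.

A semiconjugacy `h` would forbid this. Along such a lift the angle of `h` varies by only `1 / 2 ^
n`, while over a compact set the angle of `h` and that of the projection vary alike up to a bounded
error (`exists_abs_angle_sub_le`, `IsSemiconjugate.exists_abs_crossing_le`). -/

/-! ### Angles in turns, squaring on the circle, products of coverings. -/

/-- The universal covering of the circle, with the angle measured in turns. -/
def turn (x : ℝ) : Circle := Circle.exp (2 * Real.pi * x)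

theorem continuous_turn : Continuous turn := by
  unfold turn; fun_prop

theorem turn_add (x y : ℝ) : turn (x + y) = turn x * turn y := by
  simp [turn, mul_add, Circle.exp_add]

theorem turn_zero : turn 0 = 1 := by simp [turn]

theorem turn_natCast_mul (n : ℕ) (x : ℝ) : turn (n * x) = turn x ^ n := by
  induction n with
  | zero => simp [turn_zero]
  | succ n ih => rw [Nat.cast_succ, add_mul, one_mul, turn_add, ih, pow_succ]

theorem turn_eq_turn_iff {x y : ℝ} : turn x = turn y ↔ ∃ m : ℤ, x = y + m := by
  have hpi : (2 * Real.pi) ≠ 0 := by positivity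
  rw [turn, turn, Circle.exp_eq_exp]
  refine exists_congr fun m => ⟨fun h => mul_left_cancel₀ hpi ?_, fun h => ?_⟩
  · rw [h]; ring
  · rw [h]; ring

theorem turn_eq_one_iff {x : ℝ} : turn x = 1 ↔ ∃ m : ℤ, x = m := by
  rw [← turn_zero, turn_eq_turn_iff]; simp

theorem turn_surjective : Function.Surjective turn := fun z =>
  ⟨Complex.arg z / (2 * Real.pi), by
    rw [turn, mul_div_cancel₀ _ (by positivity), Circle.exp_arg]⟩

theorem isCoveringMap_turn : IsCoveringMap turn :=
  Circle.isCoveringMap_exp.comp_homeomorph (Homeomorph.mulLeft₀ (2 * Real.pi) (by positivity))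

theorem im_turn (x : ℝ) : (turn x : ℂ).im = Real.sin (2 * Real.pi * x) := by
  rw [turn, Circle.coe_exp, Complex.exp_ofReal_mul_I_im]

theorem turn_eq_toCircle (x : ℝ) : turn x = AddCircle.toCircle (x : UnitAddCircle) := by
  rw [AddCircle.toCircle_apply_mk, div_one, turn]

theorem abs_im_le_one (z : Circle) : |(z : ℂ).im| ≤ 1 :=
  (Complex.abs_im_le_norm _).trans z.norm_coe.le

theorem ncard_setOf_sq_eq (z : Circle) : {w : Circle | w ^ 2 = z}.ncard = 2 := by
  obtain ⟨x, rfl⟩ := turn_surjective z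
  have hhalf : ((turn (1 / 2) : Circle) : ℂ) = -1 := by
    rw [turn, Circle.coe_exp]
    rw [← Complex.exp_pi_mul_I]; congr 1; push_cast; ring
  have hsq : turn (x / 2) ^ 2 = turn x := by
    rw [← turn_natCast_mul]; congr 1; push_cast; ring
  have : {w : Circle | w ^ 2 = turn x} = {turn (x / 2), turn (x / 2) * turn (1 / 2)} := by
    ext w
    simp only [mem_ofPred_eq, mem_insert_iff, mem_singleton_iff]
    rw [← hsq, ← Circle.coe_inj, ← Circle.coe_inj, ← Circle.coe_inj, Circle.coe_pow, Circle.coe_pow,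
      Circle.coe_mul, hhalf, sq_eq_sq_iff_eq_or_eq_neg, mul_neg_one]
  rw [this, ncard_pair]
  intro h
  have h1 : turn (1 / 2) = 1 := by simpa using h
  rw [h1] at hhalf
  norm_num at hhalf

/-- The product of a covering map with the identity of a space is a covering map. -/
theorem _root_.IsCoveringMap.id_prodMap {E X Y : Type*} [TopologicalSpace E] [TopologicalSpace X]
    [TopologicalSpace Y] {p : E → X} (hp : IsCoveringMap p) :
    IsCoveringMap (Prod.map id p : Y × E → Y × X) := by
  rintro ⟨y, x⟩
  obtain ⟨hI, U, hxU, hU, hpU, H, hH⟩ := hp x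
  have key : IsEvenlyCovered (Prod.map id p : Y × E → Y × X) (y, x) (p ⁻¹' {x}) := by
    refine ⟨hI, Prod.snd ⁻¹' U, hxU, hU.preimage continuous_snd, hpU.preimage continuous_snd, ?_, ?_⟩
    · exact
        { toFun := fun q => (⟨(q.1.1, (H ⟨q.1.2, q.2⟩).1.1), (H ⟨q.1.2, q.2⟩).1.2⟩, (H ⟨q.1.2, q.2⟩).2)
          invFun := fun q => ⟨(q.1.1.1, (H.symm (⟨q.1.1.2, q.1.2⟩, q.2)).1),
            (H.symm (⟨q.1.1.2, q.1.2⟩, q.2)).2⟩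
          left_inv := fun q => by simp
          right_inv := fun q => by simp
          continuous_toFun := by fun_prop
          continuous_invFun := by fun_prop }
    · intro q
      exact Prod.ext rfl (hH ⟨q.1.2, q.2⟩)
  -- The sheets were indexed by the fibre of `p`; the definition of a covering map asks for the
  -- fibre of the product map.
  exact key.to_isEvenlyCovered_preimage

/-! ### Radial shears and rotations of `ℝ × S¹`. -/

/-- `x ↦ x + s * p x` is expanding by at least `1 / 2` when `p` is `1 / 2`-Lipschitz and
`|s| ≤ 1`. -/
theorem sub_div_two_le_of_lipschitz {p : ℝ → ℝ} (hp : ∀ x y, |p x - p y| ≤ |x - y| / 2) {s : ℝ}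
    (hs : |s| ≤ 1) {x y : ℝ} (hxy : x ≤ y) :
    (y - x) / 2 ≤ (y + p y * s) - (x + p x * s) := by
  have h1 : |(p x - p y) * s| ≤ |x - y| / 2 := by
    rw [abs_mul]
    calc |p x - p y| * |s| ≤ |p x - p y| * 1 := by gcongr
      _ ≤ _ := by rw [mul_one]; exact hp x y
  rw [abs_of_nonpos (sub_nonpos.2 hxy)] at h1
  have := (abs_le.1 h1).2
  nlinarith

theorem strictMono_add_mul_of_lipschitz {p : ℝ → ℝ} (hp : ∀ x y, |p x - p y| ≤ |x - y| / 2) {s : ℝ}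
    (hs : |s| ≤ 1) : StrictMono fun x => x + p x * s := fun x y hxy => by
  have := sub_div_two_le_of_lipschitz hp hs hxy.le
  simp only
  linarith

theorem continuous_of_half_lipschitz {p : ℝ → ℝ} (hp : ∀ x y, |p x - p y| ≤ |x - y| / 2) :
    Continuous p := by
  refine (LipschitzWith.of_dist_le_mul (K := 1 / 2) fun x y => ?_).continuous
  rw [Real.dist_eq, Real.dist_eq]
  refine (hp x y).trans (le_of_eq ?_)
  push_cast; ring

theorem surjective_add_mul_of_lipschitz {p : ℝ → ℝ} (hp : ∀ x y, |p x - p y| ≤ |x - y| / 2)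
    (h0 : p 0 = 0) {s : ℝ} (hs : |s| ≤ 1) : Function.Surjective fun x => x + p x * s := by
  intro u
  have hc : Continuous fun x => x + p x * s := by
    have := continuous_of_half_lipschitz hp
    fun_prop
  have hu := abs_nonneg u
  -- Expansion by at least `1 / 2` from the fixed point `0` makes the values at `±2|u|` enclose `u`.
  have h1 := sub_div_two_le_of_lipschitz hp hs (x := 0) (y := 2 * |u|) (by positivity)
  have h2 := sub_div_two_le_of_lipschitz hp hs (x := -(2 * |u|)) (y := 0) (by linarith)
  simp only [h0] at h1 h2
  refine mem_range_of_exists_le_of_exists_ge hc ⟨-(2 * |u|), ?_⟩ ⟨2 * |u|, ?_⟩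
  · have := neg_abs_le u; linarith
  · have := le_abs_self u; linarith

/-- The homeomorphism `(x, w) ↦ (x + p x * Im w, w)` of `ℝ × S¹`. -/
def shear (p : ℝ → ℝ) (hp : ∀ x y, |p x - p y| ≤ |x - y| / 2) (h0 : p 0 = 0) :
    ℝ × Circle ≃ₜ ℝ × Circle where
  toFun q := (q.1 + p q.1 * (q.2 : ℂ).im, q.2)
  invFun q := ((surjective_add_mul_of_lipschitz hp h0 (abs_im_le_one q.2) q.1).choose, q.2)
  left_inv q := by
    refine Prod.ext ?_ rfl
    exact (strictMono_add_mul_of_lipschitz hp (abs_im_le_one q.2)).injective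
      (surjective_add_mul_of_lipschitz hp h0 (abs_im_le_one q.2) _).choose_spec
  right_inv q := Prod.ext
    (surjective_add_mul_of_lipschitz hp h0 (abs_im_le_one q.2) _).choose_spec rfl
  continuous_toFun := by
    have := continuous_of_half_lipschitz hp
    have h2 : Continuous fun q : ℝ × Circle => (q.2 : ℂ).im :=
      Complex.continuous_im.comp (continuous_subtype_val.comp continuous_snd)
    fun_prop
  continuous_invFun := by
    refine Continuous.prodMk ?_ continuous_snd
    set inv : ℝ × Circle → ℝ := fun q =>
      (surjective_add_mul_of_lipschitz hp h0 (abs_im_le_one q.2) q.1).choose with hinv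
    have hspec : ∀ q, inv q + p (inv q) * (q.2 : ℂ).im = q.1 := fun q =>
      (surjective_add_mul_of_lipschitz hp h0 (abs_im_le_one q.2) q.1).choose_spec
    have himc : Continuous fun q : ℝ × Circle => (q.2 : ℂ).im :=
      Complex.continuous_im.comp (continuous_subtype_val.comp continuous_snd)
    refine continuous_iff_continuousAt.2 fun q₀ => ?_
    -- Expansion at the fixed angle of `q` bounds the distance of the two preimages by twice that of
    -- their images. The right side is continuous in `q` and vanishes at `q₀`.
    have hbound : ∀ q, dist (inv q) (inv q₀) ≤
        2 * |(q.1 - q₀.1) - p (inv q₀) * ((q.2 : ℂ).im - (q₀.2 : ℂ).im)| := by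
      intro q
      have e : (q.1 - q₀.1) - p (inv q₀) * ((q.2 : ℂ).im - (q₀.2 : ℂ).im) =
          (inv q + p (inv q) * (q.2 : ℂ).im) - (inv q₀ + p (inv q₀) * (q.2 : ℂ).im) := by
        rw [hspec q]; linear_combination hspec q₀
      rw [e, Real.dist_eq]
      rcases le_total (inv q) (inv q₀) with h | h
      · have := sub_div_two_le_of_lipschitz hp (abs_im_le_one q.2) h
        rw [abs_sub_comm, abs_of_nonneg (sub_nonneg.2 h)]
        have := neg_abs_le ((inv q + p (inv q) * (q.2 : ℂ).im) -
          (inv q₀ + p (inv q₀) * (q.2 : ℂ).im))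
        linarith
      · have := sub_div_two_le_of_lipschitz hp (abs_im_le_one q.2) h
        rw [abs_of_nonneg (sub_nonneg.2 h)]
        have := le_abs_self ((inv q + p (inv q) * (q.2 : ℂ).im) -
          (inv q₀ + p (inv q₀) * (q.2 : ℂ).im))
        linarith
    refine tendsto_iff_dist_tendsto_zero.2 (squeeze_zero (fun _ => dist_nonneg) hbound ?_)
    have hc : Continuous fun q : ℝ × Circle =>
        2 * |(q.1 - q₀.1) - p (inv q₀) * ((q.2 : ℂ).im - (q₀.2 : ℂ).im)| := by fun_prop
    have := hc.tendsto q₀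
    simpa using this

/-- The homeomorphism `(x, z) ↦ (x, z e^{2πi g x})` of `ℝ × S¹`. -/
def spin (g : C(ℝ, ℝ)) : ℝ × Circle ≃ₜ ℝ × Circle where
  toFun q := (q.1, q.2 * turn (g q.1))
  invFun q := (q.1, q.2 * (turn (g q.1))⁻¹)
  left_inv q := by simp
  right_inv q := by simp
  continuous_toFun := by have := continuous_turn; fun_prop
  continuous_invFun := by have := continuous_turn; fun_prop

/-! ### The chart of the annulus adapted to the sequence. -/

section

/-- The piecewise affine interpolation of a sequence. -/
def interpolate (c : ℤ → ℝ) (x : ℝ) : ℝ :=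
  c ⌊x⌋ + (c (⌊x⌋ + 1) - c ⌊x⌋) * Int.fract x

theorem interpolate_intCast (c : ℤ → ℝ) (n : ℤ) : interpolate c n = c n := by
  simp [interpolate]

theorem interpolate_eq_of_mem_Icc (c : ℤ → ℝ) {n : ℤ} {x : ℝ} (hx : x ∈ Icc (n : ℝ) (n + 1)) :
    interpolate c x = c n + (c (n + 1) - c n) * (x - n) := by
  rcases hx.2.lt_or_eq with h | h
  · have : ⌊x⌋ = n := Int.floor_eq_iff.2 ⟨hx.1, h⟩
    rw [interpolate, Int.fract, this]
  · have e : x = ((n + 1 : ℤ) : ℝ) := by push_cast; exact h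
    rw [h, ← Int.cast_one, ← Int.cast_add, interpolate_intCast]
    push_cast; ring

theorem strictMono_interpolate {c : ℤ → ℝ} (hc : StrictMono c) : StrictMono (interpolate c) := by
  intro x y hxy
  have hpos : ∀ n : ℤ, 0 < c (n + 1) - c n := fun n => sub_pos.2 (hc (lt_add_one n))
  have hx := Int.fract_lt_one x
  have hy := Int.fract_nonneg y
  rcases (Int.floor_mono hxy.le).lt_or_eq with h | h
  · have h1 : c (⌊x⌋ + 1) ≤ c ⌊y⌋ := hc.monotone h
    have h2 := mul_lt_mul_of_pos_left hx (hpos ⌊x⌋)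
    have h3 := mul_nonneg (hpos ⌊y⌋).le hy
    unfold interpolate
    linarith
  · have h1 : Int.fract x < Int.fract y := by
      rw [Int.fract, Int.fract, h]; linarith
    have h2 := mul_lt_mul_of_pos_left h1 (hpos ⌊y⌋)
    unfold interpolate
    rw [h]
    linarith

variable {a : ℤ → Ioo (0 : ℝ) 1}

theorem exists_mem_Ico_succ (ha_bot : Tendsto (fun n => (a n : ℝ)) atBot (𝓝 0))
    (ha_top : Tendsto (fun n => (a n : ℝ)) atTop (𝓝 1)) (ha : StrictMono a) {y : ℝ}
    (hy : y ∈ Ioo (0 : ℝ) 1) : ∃ n : ℤ, y ∈ Ico (a n : ℝ) (a (n + 1)) := by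
  obtain ⟨m, hm⟩ := (ha_bot.eventually (gt_mem_nhds hy.1)).exists
  obtain ⟨M, hM⟩ := (ha_top.eventually (lt_mem_nhds hy.2)).exists
  obtain ⟨n, hn, hmax⟩ := Int.exists_greatest_of_bdd (P := fun n => (a n : ℝ) ≤ y)
    ⟨M, fun z hz => ha.le_iff_le.1 (Subtype.coe_le_coe.1 (hz.trans hM.le))⟩ ⟨m, hm.le⟩
  refine ⟨n, hn, lt_of_not_ge fun h => ?_⟩
  have := hmax _ h
  omega

/-- The homeomorphism of the line onto `(0,1)` that sends `n` to `a n` and is affine between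
integers. -/
def radial (ha : StrictMono a) (ha_bot : Tendsto (fun n => (a n : ℝ)) atBot (𝓝 0))
    (ha_top : Tendsto (fun n => (a n : ℝ)) atTop (𝓝 1)) : ℝ ≃o Ioo (0 : ℝ) 1 :=
  StrictMono.orderIsoOfSurjective
    (fun x => ⟨interpolate (fun n => a n) x, by
      have hc : StrictMono fun n => (a n : ℝ) := ha
      have hm := strictMono_interpolate hc
      constructor
      · refine (a ⌊x⌋).2.1.trans_le ?_
        rw [← interpolate_intCast (fun n => (a n : ℝ)) ⌊x⌋]
        exact hm.monotone (Int.floor_le x)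
      · refine lt_of_le_of_lt ?_ (a ⌈x⌉).2.2
        rw [← interpolate_intCast (fun n => (a n : ℝ)) ⌈x⌉]
        exact hm.monotone (Int.le_ceil x)⟩)
    (fun _ _ h => strictMono_interpolate (c := fun n => (a n : ℝ)) ha h)
    (fun y => by
      obtain ⟨n, h1, h2⟩ := exists_mem_Ico_succ ha_bot ha_top ha y.2
      have hpos : 0 < (a (n + 1) : ℝ) - a n := sub_pos.2 (ha (lt_add_one n))
      refine ⟨n + (y - a n) / (a (n + 1) - a n), Subtype.ext ?_⟩
      have hle : ((y : ℝ) - a n) / (a (n + 1) - a n) ≤ 1 := (div_le_one hpos).2 (by linarith)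
      have hnn : 0 ≤ ((y : ℝ) - a n) / (a (n + 1) - a n) :=
        div_nonneg (by linarith) hpos.le
      have := interpolate_eq_of_mem_Icc (fun n => (a n : ℝ))
        (n := n) (x := n + (y - a n) / (a (n + 1) - a n)) ⟨by linarith, by linarith⟩
      refine this.trans ?_
      field_simp
      ring)

variable (ha : StrictMono a) (ha_bot : Tendsto (fun n => (a n : ℝ)) atBot (𝓝 0))
    (ha_top : Tendsto (fun n => (a n : ℝ)) atTop (𝓝 1))

theorem coe_radial (x : ℝ) : (radial ha ha_bot ha_top x : ℝ) = interpolate (fun n => a n) x := rfl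

theorem radial_intCast (n : ℤ) : radial ha ha_bot ha_top n = a n :=
  Subtype.ext (interpolate_intCast (fun n => (a n : ℝ)) n)

theorem radial_mem_Icc_iff (n : ℤ) (x : ℝ) :
    (a n ≤ radial ha ha_bot ha_top x ∧ radial ha ha_bot ha_top x ≤ a (n + 1)) ↔
      x ∈ Icc (n : ℝ) (n + 1) := by
  rw [← radial_intCast ha ha_bot ha_top n, ← radial_intCast ha ha_bot ha_top (n + 1),
    OrderIso.le_iff_le, OrderIso.le_iff_le, mem_Icc]
  push_cast; rfl

/-- The parametrization of the annulus by `ℝ × S¹` which makes `A_n` the part `[n, n + 1] × S¹`. -/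
def chart : ℝ × Circle ≃ₜ Annulus :=
  (radial ha ha_bot ha_top).toHomeomorph.prodCongr (Homeomorph.refl Circle)

theorem chart_apply (q : ℝ × Circle) :
    chart ha ha_bot ha_top q = (radial ha ha_bot ha_top q.1, q.2) := rfl

theorem chart_mem_subAnnulus_iff (n : ℤ) (q : ℝ × Circle) :
    chart ha ha_bot ha_top q ∈ subAnnulus a n ↔ q.1 ∈ Icc (n : ℝ) (n + 1) :=
  radial_mem_Icc_iff ha ha_bot ha_top n q.1

end

/-! ### The bands. -/

/-- A third of the length of the `m`-th band. -/
def bandThird (m : ℕ) : ℝ := 1 / (3 * (m + 1) * (m + 2))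

/-- The lower end of the `m`-th band. -/
def bandLow (m : ℕ) : ℝ := m + 1 / (m + 2)

/-- The bands `(m + 1/(m+2), m + 1/(m+1))`, for `m : ℕ`; their fractional parts are disjoint. -/
def band (m : ℕ) : Set ℝ := Ioo (bandLow m) (bandLow m + 3 * bandThird m)

/-- The complement of the union of the bands. -/
def offBand : Set ℝ := (⋃ m, band m)ᶜ

theorem bandThird_pos (m : ℕ) : 0 < bandThird m := by unfold bandThird; positivity

theorem bandLow_add (m : ℕ) : bandLow m + 3 * bandThird m = m + 1 / (m + 1) := by
  unfold bandLow bandThird; field_simp; ring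

theorem natCast_lt_bandLow (m : ℕ) : (m : ℝ) < bandLow m := by
  unfold bandLow
  have : (0 : ℝ) < 1 / (m + 2) := by positivity
  linarith

theorem bandLow_add_le (m : ℕ) : bandLow m + 3 * bandThird m ≤ m + 1 := by
  rw [bandLow_add]
  have : (1 : ℝ) / (m + 1) ≤ 1 := by
    rw [div_le_one (by positivity)]; linarith [Nat.cast_nonneg (α := ℝ) m]
  linarith

theorem eq_of_mem_band {m : ℕ} {x : ℝ} (hx : x ∈ band m) {k : ℕ} (h1 : (k : ℝ) < x)
    (h2 : x ≤ k + 1) : k = m := by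
  have h3 := (natCast_lt_bandLow m).trans hx.1
  have h4 := hx.2.trans_le (bandLow_add_le m)
  have h5 : k < m + 1 := by exact_mod_cast h1.trans h4
  have h6 : m < k + 1 := by exact_mod_cast h3.trans_le h2
  omega

theorem eq_of_mem_band_of_mem_band {m k : ℕ} {x : ℝ} (hm : x ∈ band m) (hk : x ∈ band k) : k = m :=
  eq_of_mem_band hm ((natCast_lt_bandLow k).trans hk.1) (hk.2.trans_le (bandLow_add_le k)).le

theorem mem_offBand {x : ℝ} : x ∈ offBand ↔ ∀ m, x ∉ band m := by simp [offBand]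

theorem mem_offBand_of_nonpos {x : ℝ} (hx : x ≤ 0) : x ∈ offBand :=
  mem_offBand.2 fun m h =>
    ((m.cast_nonneg.trans_lt (natCast_lt_bandLow m)).trans h.1).not_ge hx

theorem mem_offBand_of_notMem_band {k : ℕ} {x : ℝ} (h1 : (k : ℝ) < x)
    (h2 : x ≤ k + 1) (h : x ∉ band k) : x ∈ offBand :=
  mem_offBand.2 fun _ hm => h (eq_of_mem_band hm h1 h2 ▸ hm)

theorem intCast_mem_offBand (n : ℤ) : (n : ℝ) ∈ offBand := by
  rcases le_or_gt n 0 with h | h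
  · exact mem_offBand_of_nonpos (by exact_mod_cast h)
  · obtain ⟨k, rfl⟩ : ∃ k : ℕ, n = k + 1 := ⟨(n - 1).toNat, by omega⟩
    refine mem_offBand_of_notMem_band (k := k) (by push_cast; linarith) (by push_cast; rfl) fun h => ?_
    have := h.2.trans_le (bandLow_add_le k)
    push_cast at this
    exact lt_irrefl _ this

theorem bandLow_mem_offBand (m : ℕ) : bandLow m ∈ offBand :=
  mem_offBand_of_notMem_band (natCast_lt_bandLow m)
    (by linarith [bandThird_pos m, bandLow_add_le m]) fun h => lt_irrefl _ h.1

theorem bandLow_add_mem_offBand (m : ℕ) : bandLow m + 3 * bandThird m ∈ offBand :=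
  mem_offBand_of_notMem_band (by linarith [bandThird_pos m, natCast_lt_bandLow m])
    (bandLow_add_le m) fun h => lt_irrefl _ h.2

/-- Below `m`, the translates of the `m`-th band miss all the bands. -/
theorem sub_add_mem_offBand {m k : ℕ} (hk : k < m) {x : ℝ}
    (hx : x ∈ Icc (bandLow m) (bandLow m + 3 * bandThird m)) : x - m + k ∈ offBand := by
  have h1 := natCast_lt_bandLow m
  have h2 := bandLow_add_le m
  refine mem_offBand_of_notMem_band (k := k) (by linarith [hx.1]) (by linarith [hx.2]) fun h => ?_
  have h3 := h.1
  have h4 := hx.2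
  rw [bandLow_add] at h4
  unfold bandLow at h3
  -- The fractional part is at most `1 / (m + 1)`, whereas the `k`-th band only begins beyond `1 /
  -- (k + 2)`.
  have h5 : (1 : ℝ) / (m + 1) ≤ 1 / (k + 2) := by
    have : (k : ℝ) + 1 ≤ m := by exact_mod_cast hk
    apply one_div_le_one_div_of_le <;> first | positivity | linarith
  linarith

/-! ### The radial and angular displacements. -/

/-- The radial displacement. -/
def push (x : ℝ) : ℝ := Metric.infDist x offBand / 2

theorem push_lipschitz (x y : ℝ) : |push x - push y| ≤ |x - y| / 2 := by
  have h1 := Metric.infDist_le_infDist_add_dist (s := offBand) (x := x) (y := y)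
  have h2 := Metric.infDist_le_infDist_add_dist (s := offBand) (x := y) (y := x)
  rw [dist_comm] at h2
  rw [Real.dist_eq] at h1 h2
  unfold push
  rw [abs_le]
  constructor <;> linarith

theorem push_eq_zero {x : ℝ} (hx : x ∈ offBand) : push x = 0 := by
  rw [push, Metric.infDist_zero_of_mem hx, zero_div]

/-- In the middle third of a band every point off the bands is at distance at least a third, so a
point `y` at exactly that distance realizes the infimum. -/
theorem push_eq {m : ℕ} {x y : ℝ} (hy : y ∈ offBand) (hxy : |x - y| = bandThird m)
    (h1 : bandLow m + bandThird m ≤ x) (h2 : x ≤ bandLow m + 2 * bandThird m) :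
    push x = bandThird m / 2 := by
  rw [push]
  congr 1
  refine le_antisymm ?_ ((Metric.le_infDist ⟨y, hy⟩).2 fun z hz => ?_)
  · rw [← hxy, ← Real.dist_eq]; exact Metric.infDist_le_dist_of_mem hy
  · rw [Real.dist_eq]
    by_contra! hlt
    rw [abs_lt] at hlt
    exact mem_offBand.1 hz m ⟨by linarith [hlt.2], by linarith [hlt.1]⟩

theorem push_left (m : ℕ) : push (bandLow m + bandThird m) = bandThird m / 2 :=
  push_eq (bandLow_mem_offBand m) (by rw [add_sub_cancel_left, abs_of_pos (bandThird_pos m)]) le_rfl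
    (by linarith [bandThird_pos m])

theorem push_right (m : ℕ) : push (bandLow m + 2 * bandThird m) = bandThird m / 2 :=
  push_eq (bandLow_add_mem_offBand m)
    (by rw [abs_sub_comm, abs_of_nonneg] <;> linarith [bandThird_pos m])
    (by linarith [bandThird_pos m]) le_rfl

/-- The tent function of height one around the point at two thirds of the `m`-th band. -/
def tent (m : ℕ) (x : ℝ) : ℝ := max 0 (1 - |x - (bandLow m + 2 * bandThird m)| / bandThird m)

theorem continuous_tent (m : ℕ) : Continuous (tent m) := by unfold tent; fun_prop

theorem lt_of_tent_ne_zero {m : ℕ} {x : ℝ} (h : tent m x ≠ 0) :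
    bandLow m + bandThird m < x ∧ x < bandLow m + 3 * bandThird m := by
  have h1 : |x - (bandLow m + 2 * bandThird m)| < bandThird m := by
    by_contra! hle
    refine h (max_eq_left ?_)
    have := (one_le_div (bandThird_pos m)).2 hle
    linarith
  rw [abs_lt] at h1
  constructor <;> linarith [h1.1, h1.2]

theorem mem_band_of_tent_ne_zero {m : ℕ} {x : ℝ} (h : tent m x ≠ 0) : x ∈ band m :=
  ⟨by linarith [(lt_of_tent_ne_zero h).1, bandThird_pos m], (lt_of_tent_ne_zero h).2⟩

theorem tent_peak (m : ℕ) : tent m (bandLow m + 2 * bandThird m) = 1 := by simp [tent]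

/-- The `m`-th tent lives above `m`, so only finitely many are nonzero below any given bound. The
coefficients may therefore grow freely. -/
theorem locallyFinite_support_tent (c : ℕ → ℝ) :
    LocallyFinite fun m => Function.support fun x => c m * tent m x := by
  intro x
  refine ⟨Iio (x + 1), Iio_mem_nhds (by linarith), (finite_Iic ⌈x + 1⌉₊).subset ?_⟩
  rintro m ⟨y, hy, hyx⟩
  have h1 := mem_band_of_tent_ne_zero (right_ne_zero_of_mul hy)
  have h2 := (natCast_lt_bandLow m).trans h1.1
  have h3 : (m : ℝ) ≤ ⌈x + 1⌉₊ := (h2.trans hyx).le.trans (Nat.le_ceil _)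
  exact_mod_cast h3

/-- The angular displacement: it oscillates more and more in the successive bands. -/
def twist : C(ℝ, ℝ) where
  -- The factor `2 ^ m` compensates the division of angles under `m` pullbacks. The `1 / 2` cancels
  -- the half turn made in the band, so that the lifted arc gains a whole number of turns.
  toFun x := ∑ᶠ m : ℕ, (1 / 2 - (m + 1) * 2 ^ m : ℝ) * tent m x
  continuous_toFun := continuous_finsum (fun m => continuous_const.mul (continuous_tent m))
    (locallyFinite_support_tent _)

theorem twist_eq_single {m : ℕ} {x : ℝ} (hx : ∀ k, k ≠ m → x ∉ band k) :
    twist x = (1 / 2 - (m + 1) * 2 ^ m) * tent m x := by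
  refine finsum_eq_single _ m fun k hk => ?_
  by_contra h
  exact hx k hk (mem_band_of_tent_ne_zero (right_ne_zero_of_mul h))

theorem twist_eq_zero {x : ℝ} (hx : x ∈ offBand) : twist x = 0 := by
  rw [twist_eq_single (m := 0) fun k _ => mem_offBand.1 hx k]
  by_contra h
  exact mem_offBand.1 hx 0 (mem_band_of_tent_ne_zero (right_ne_zero_of_mul h))

theorem twist_left (m : ℕ) : twist (bandLow m + bandThird m) = 0 := by
  have hpos := bandThird_pos m
  rw [twist_eq_single (m := m) fun k hk h =>
    hk (eq_of_mem_band_of_mem_band ⟨by linarith, by linarith⟩ h)]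
  by_contra h
  exact lt_irrefl _ (lt_of_tent_ne_zero (right_ne_zero_of_mul h)).1

theorem twist_right (m : ℕ) : twist (bandLow m + 2 * bandThird m) = 1 / 2 - (m + 1) * 2 ^ m := by
  have hpos := bandThird_pos m
  rw [twist_eq_single (m := m) fun k hk h =>
    hk (eq_of_mem_band_of_mem_band ⟨by linarith, by linarith⟩ h), tent_peak, mul_one]

/-! ### The model covering of `ℝ × S¹`. -/

section

/-- The radial shear in the bands. -/
def bandShear : ℝ × Circle ≃ₜ ℝ × Circle :=
  shear push push_lipschitz (push_eq_zero (mem_offBand_of_nonpos le_rfl))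

/-- The covering `(x, z) ↦ (x + 1, z²)` of `ℝ × S¹`, precomposed with a homeomorphism that preserves
each `[n, n + 1] × S¹`. -/
def modelMap : C(ℝ × Circle, ℝ × Circle) where
  toFun q := ((bandShear (spin twist q)).1 + 1, (bandShear (spin twist q)).2 ^ 2)
  continuous_toFun := by
    have h1 := bandShear.continuous.comp (spin twist).continuous
    exact ((continuous_fst.comp h1).add continuous_const).prodMk ((continuous_snd.comp h1).pow 2)

theorem modelMap_apply (q : ℝ × Circle) :
    modelMap q = (q.1 + push q.1 * ((q.2 * turn (twist q.1) : Circle) : ℂ).im + 1,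
      (q.2 * turn (twist q.1)) ^ 2) := rfl

/-- Squaring the angle is a covering, and all the other factors are homeomorphisms. -/
theorem isCoveringMap_modelMap : IsCoveringMap modelMap := by
  have h : IsCoveringMap (Prod.map id (· ^ 2) : ℝ × Circle → ℝ × Circle) :=
    (Circle.isQuotientCoveringMap_npow 2).isCoveringMap.id_prodMap
  exact (h.comp_homeomorph ((spin twist).trans bandShear)).homeomorph_comp
    ((Homeomorph.addRight (1 : ℝ)).prodCongr (Homeomorph.refl Circle))

theorem ncard_preimage_modelMap (y : ℝ × Circle) : (modelMap ⁻¹' {y}).ncard = 2 := by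
  have : modelMap ⁻¹' {y} = ((spin twist).trans bandShear).symm ''
      (Prod.mk (y.1 - 1) '' {w | w ^ 2 = y.2}) := by
    rw [← image_comp]
    ext q
    simp only [mem_preimage, mem_singleton_iff, mem_image, mem_ofPred_eq, Function.comp_apply]
    constructor
    · rintro rfl
      refine ⟨(bandShear (spin twist q)).2, rfl, ?_⟩
      rw [Homeomorph.symm_apply_eq]
      exact Prod.ext (by simp [modelMap]) rfl
    · rintro ⟨w, hw, rfl⟩
      have h := ((spin twist).trans bandShear).apply_symm_apply (y.1 - 1, w)
      rw [Homeomorph.trans_apply] at h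
      change ((bandShear (spin twist _)).1 + 1, (bandShear (spin twist _)).2 ^ 2) = y
      rw [h]
      exact Prod.ext (by simp) hw
  rw [this, ncard_image_of_injective _ (Homeomorph.injective _),
    ncard_image_of_injective _ (Prod.mk_right_injective _), ncard_setOf_sq_eq]

theorem modelMap_of_mem_offBand {q : ℝ × Circle} (hq : q.1 ∈ offBand) :
    modelMap q = (q.1 + 1, q.2 ^ 2) := by
  rw [modelMap_apply, push_eq_zero hq, twist_eq_zero hq, turn_zero, zero_mul, add_zero, mul_one]

theorem modelMap_fst_mem_Icc_iff (n : ℤ) (q : ℝ × Circle) :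
    (modelMap q).1 ∈ Icc ((n + 1 : ℤ) : ℝ) ((n + 1 : ℤ) + 1) ↔ q.1 ∈ Icc (n : ℝ) (n + 1) := by
  -- The height is frozen at its value at `q`. The resulting increasing function of the radius fixes
  -- the integers, since they lie off the bands.
  have hm := strictMono_add_mul_of_lipschitz push_lipschitz
    (abs_im_le_one (q.2 * turn (twist q.1)))
  have hn : ∀ k : ℤ, push k = 0 := fun k => push_eq_zero (intCast_mem_offBand k)
  have h1 := hm.le_iff_le (a := (n : ℝ)) (b := q.1)
  have h2 := hm.le_iff_le (a := q.1) (b := ((n + 1 : ℤ) : ℝ))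
  simp only [hn, zero_mul, add_zero] at h1 h2
  push_cast at h2
  rw [modelMap_apply, mem_Icc, mem_Icc, ← h1, ← h2]
  push_cast
  rw [add_le_add_iff_right, add_le_add_iff_right]

theorem modelMap_iterate {m : ℕ} {q : ℝ × Circle} (hq : ∀ k < m, q.1 + k ∈ offBand) :
    modelMap^[m] q = (q.1 + m, q.2 ^ 2 ^ m) := by
  induction m with
  | zero => simp
  | succ m ih =>
    rw [Function.iterate_succ_apply', ih fun k hk => hq k (hk.trans (Nat.lt_succ_self m)),
      modelMap_of_mem_offBand (hq m (Nat.lt_succ_self m))]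
    exact Prod.ext (by push_cast; ring) (by rw [pow_succ 2 m, pow_mul])

/-! ### Transfer to the annulus. -/

variable {a : ℤ → Ioo (0 : ℝ) 1} (ha : StrictMono a)
    (ha_bot : Tendsto (fun n => (a n : ℝ)) atBot (𝓝 0))
    (ha_top : Tendsto (fun n => (a n : ℝ)) atTop (𝓝 1))

/-- The map of the annulus that reads as `modelMap` in the chart. -/
def annulusMap : C(Annulus, Annulus) :=
  ⟨chart ha ha_bot ha_top ∘ modelMap ∘ (chart ha ha_bot ha_top).symm,
    (chart ha ha_bot ha_top).continuous.comp (modelMap.continuous.comp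
      (chart ha ha_bot ha_top).symm.continuous)⟩

theorem semiconj_chart :
    Function.Semiconj (chart ha ha_bot ha_top) modelMap (annulusMap ha ha_bot ha_top) := fun q => by
  change _ = chart ha ha_bot ha_top (modelMap ((chart ha ha_bot ha_top).symm _))
  rw [Homeomorph.symm_apply_apply]

theorem isCoveringMap_annulusMap : IsCoveringMap (annulusMap ha ha_bot ha_top) :=
  (isCoveringMap_modelMap.comp_homeomorph (chart ha ha_bot ha_top).symm).homeomorph_comp
    (chart ha ha_bot ha_top)

theorem ncard_preimage_annulusMap (y : Annulus) :
    (annulusMap ha ha_bot ha_top ⁻¹' {y}).ncard = 2 := by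
  have : annulusMap ha ha_bot ha_top ⁻¹' {y} = chart ha ha_bot ha_top ''
      (modelMap ⁻¹' {(chart ha ha_bot ha_top).symm y}) := by
    rw [(chart ha ha_bot ha_top).image_eq_preimage_symm]
    ext q
    simp [annulusMap, Homeomorph.eq_symm_apply]
  rw [this, ncard_image_of_injective _ (Homeomorph.injective _), ncard_preimage_modelMap]

/-- The angular displacement as a function on the annulus. -/
def annulusTwist (p : Annulus) : ℝ := twist ((radial ha ha_bot ha_top).symm p.1)

theorem continuous_annulusTwist : Continuous (annulusTwist ha ha_bot ha_top) :=
  twist.continuous.comp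
    ((radial ha ha_bot ha_top).toHomeomorph.symm.continuous.comp continuous_fst)

theorem annulusMap_snd (p : Annulus) : (annulusMap ha ha_bot ha_top p).2 =
    (p.2 * turn (annulusTwist ha ha_bot ha_top p)) ^ 2 := rfl

/-- The angular displacement is a single-valued real function on the annulus, so its contribution
cancels around a loop and only the squaring counts. -/
theorem hasDegree_annulusMap : HasDegree (annulusMap ha ha_bot ha_top) 2 := by
  intro γ
  have hcast : Continuous fun t : unitInterval => γ ((t : ℝ) : UnitAddCircle) :=
    (loopPath γ).continuous
  set θ := angle (loopPath (proj.comp γ))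
  have hang : IsAngle θ (loopPath (proj.comp γ)) := isAngle_angle _
  let θ' : C(unitInterval, ℝ) :=
    ⟨fun t => 2 * (θ t + annulusTwist ha ha_bot ha_top (γ ((t : ℝ) : UnitAddCircle))), by
      have := (continuous_annulusTwist ha ha_bot ha_top).comp hcast
      exact continuous_const.mul (θ.continuous.add this)⟩
  have hang' : IsAngle θ' (loopPath (proj.comp ((annulusMap ha ha_bot ha_top).comp γ))) := by
    intro t
    change turn (2 * (θ t + _)) = (annulusMap ha ha_bot ha_top (γ ((t : ℝ) : UnitAddCircle))).2
    have h1 : turn (θ t) = (γ ((t : ℝ) : UnitAddCircle)).2 := hang t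
    rw [annulusMap_snd, ← h1, ← turn_add, ← turn_natCast_mul]
    norm_num
  have e1 := loopDegree_eq _ hang
  have e2 := loopDegree_eq _ hang'
  have h01 : ((1 : ℝ) : UnitAddCircle) = ((0 : ℝ) : UnitAddCircle) := by
    rw [AddCircle.coe_period 1, AddCircle.coe_zero]
  have : (homologyClass ((annulusMap ha ha_bot ha_top).comp γ) : ℝ) = 2 * homologyClass γ := by
    refine e2.trans ?_
    rw [homologyClass, e1]
    simp only [θ', ContinuousMap.coe_mk, Icc.coe_zero, Icc.coe_one, h01]
    ring
  exact_mod_cast this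

theorem preimage_subAnnulus (n : ℤ) :
    annulusMap ha ha_bot ha_top ⁻¹' subAnnulus a (n + 1) = subAnnulus a n := by
  ext p
  obtain ⟨q, rfl⟩ := (chart ha ha_bot ha_top).surjective p
  rw [mem_preimage, ← (semiconj_chart ha ha_bot ha_top) q, chart_mem_subAnnulus_iff,
    chart_mem_subAnnulus_iff, modelMap_fst_mem_Icc_iff]

theorem annulusMap_boundary (n : ℤ) (z : Circle) :
    annulusMap ha ha_bot ha_top (a n, z) = (a (n + 1), z ^ 2) := by
  have h : (a n, z) = chart ha ha_bot ha_top (n, z) := by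
    rw [chart_apply, radial_intCast]
  rw [h, ← (semiconj_chart ha ha_bot ha_top) _, modelMap_of_mem_offBand (intCast_mem_offBand n),
    chart_apply, ← radial_intCast ha ha_bot ha_top (n + 1)]
  push_cast; rfl

/-- All bands lie above `0`, so on these annuli the model is `(x, z) ↦ (x + 1, z²)`, and the chart
is affine on both the source and the target interval. -/
theorem annulusMap_affine {n : ℤ} (hn : n ≤ -1) {p : Annulus} (hp : p ∈ subAnnulus a n) :
    ((annulusMap ha ha_bot ha_top p).1 : ℝ) = a (n + 1) +
      (a (n + 2) - a (n + 1) : ℝ) * ((p.1 - a n : ℝ) / (a (n + 1) - a n : ℝ)) ∧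
    (annulusMap ha ha_bot ha_top p).2 = p.2 ^ 2 := by
  obtain ⟨q, rfl⟩ := (chart ha ha_bot ha_top).surjective p
  rw [chart_mem_subAnnulus_iff] at hp
  have hn' : (n : ℝ) + 1 ≤ 0 := by exact_mod_cast (by omega : n + 1 ≤ 0)
  rw [← (semiconj_chart ha ha_bot ha_top) _,
    modelMap_of_mem_offBand (mem_offBand_of_nonpos (hp.2.trans hn'))]
  refine ⟨?_, rfl⟩
  rw [chart_apply, chart_apply, coe_radial, coe_radial,
    interpolate_eq_of_mem_Icc (n := n + 1) _
      ⟨by push_cast; linarith [hp.1], by push_cast; linarith [hp.2]⟩,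
    interpolate_eq_of_mem_Icc _ hp]
  have hpos : (a (n + 1) : ℝ) - a n ≠ 0 :=
    (sub_pos.2 (Subtype.coe_lt_coe.2 (ha (lt_add_one n)))).ne'
  rw [add_sub_cancel_left, mul_div_cancel_left₀ _ hpos, add_assoc n 1 1]
  push_cast
  norm_num

end

/-! ### Winding of lifts under a semiconjugacy. -/

section

theorem IsAngle.sub_eq {θ θ' : C(unitInterval, ℝ)} {γ : C(unitInterval, Circle)}
    (h : IsAngle θ γ) (h' : IsAngle θ' γ) : θ' 1 - θ' 0 = θ 1 - θ 0 := by
  obtain ⟨m, hm⟩ := h.exists_int h'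
  rw [hm, hm]; ring

/-- The circle of radius `r`, with starting point `(r, z)`. -/
def circleLoop (r : Ioo (0 : ℝ) 1) (z : Circle) : C(UnitAddCircle, Annulus) :=
  ⟨fun s => (r, z * AddCircle.toCircle s),
    continuous_const.prodMk (continuous_const.mul AddCircle.continuous_toCircle)⟩

theorem circleLoop_coe (r : Ioo (0 : ℝ) 1) (x t : ℝ) :
    circleLoop r (turn x) (t : UnitAddCircle) = (r, turn (x + t)) := by
  rw [turn_add, turn_eq_toCircle t]; rfl

theorem injective_circleLoop (r : Ioo (0 : ℝ) 1) (z : Circle) :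
    Function.Injective (circleLoop r z) := fun _ _ h =>
  AddCircle.injective_toCircle one_ne_zero (mul_left_cancel (congrArg Prod.snd h))

theorem homologyClass_circleLoop (r : Ioo (0 : ℝ) 1) (z : Circle) :
    homologyClass (circleLoop r z) = 1 := by
  obtain ⟨x, rfl⟩ := turn_surjective z
  have h : IsAngle ⟨fun t => x + t, by fun_prop⟩ (loopPath (proj.comp (circleLoop r (turn x)))) :=
    fun t => (congrArg Prod.snd (circleLoop_coe r x t)).symm
  have := loopDegree_eq _ h
  simp only [ContinuousMap.coe_mk, Icc.coe_zero, Icc.coe_one] at this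
  have h2 : (homologyClass (circleLoop r (turn x)) : ℝ) = 1 := this.trans (by ring)
  exact_mod_cast h2

/-- A map `A → S¹` that induces the identity on `H₁` winds the arcs in a compact set as the
projection does, up to a bounded error. -/
theorem exists_abs_angle_sub_le (h : C(Annulus, Circle))
    (hh : ∀ γ : C(UnitAddCircle, Annulus), loopDegree (h.comp γ) = homologyClass γ)
    {K : Set Annulus} (hK : IsCompact K) (r : ℝ ≃ₜ Ioo (0 : ℝ) 1) :
    ∃ C : ℝ, ∀ β : C(unitInterval, Annulus), β 0 ∈ K → β 1 ∈ K →
      ∀ θ η : C(unitInterval, ℝ), IsAngle θ (proj.comp β) → IsAngle η (h.comp β) →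
        |(η 1 - η 0) - (θ 1 - θ 0)| ≤ C := by
  have hcov : Continuous fun q : ℝ × ℝ => ((r q.1, turn q.2) : Annulus) :=
    (r.continuous.comp continuous_fst).prodMk (continuous_turn.comp continuous_snd)
  obtain ⟨e₀, he₀⟩ := turn_surjective (h (r 0, turn 0))
  -- `H` is the angle of `h` on the universal covering of the annulus.
  obtain ⟨H, ⟨-, hH⟩, -⟩ := isCoveringMap_turn.existsUnique_continuousMap_lifts
    (h.comp ⟨_, hcov⟩) ((0, 0) : ℝ × ℝ) e₀ he₀
  have hHt : ∀ x t : ℝ, turn (H (x, t)) = h (r x, turn t) := fun x t => congrFun hH (x, t)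
  -- The identity on `H₁` says that `h` has degree one on each circle. So `H - t` is periodic, and
  -- it is bounded over `K` by compactness of one period.
  have hper : ∀ x : ℝ, Function.Periodic (fun t => H (x, t) - t) 1 := by
    intro x t
    have hang : IsAngle ⟨fun s => H (x, t + s), by fun_prop⟩
        (loopPath (h.comp (circleLoop (r x) (turn t)))) := by
      intro s
      refine (hHt x (t + s)).trans ?_
      rw [← circleLoop_coe]; rfl
    have h1 := loopDegree_eq _ hang
    rw [hh, homologyClass_circleLoop] at h1
    simp only [ContinuousMap.coe_mk, Icc.coe_zero, Icc.coe_one, Int.cast_one, add_zero] at h1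
    simp only
    linarith
  have hcomp : IsCompact (((r.symm ∘ Prod.fst) '' K) ×ˢ Icc (0 : ℝ) 1) :=
    (hK.image (r.symm.continuous.comp continuous_fst)).prod isCompact_Icc
  obtain ⟨C, hC⟩ := hcomp.exists_bound_of_continuousOn (f := fun q : ℝ × ℝ => H q - q.2)
    (by fun_prop)
  have hbound : ∀ x ∈ (r.symm ∘ Prod.fst) '' K, ∀ t, |H (x, t) - t| ≤ C := by
    intro x hx t
    have h1 := (hper x).sub_zsmul_eq (x := t) ⌊t⌋
    simp only [zsmul_eq_mul, mul_one, Int.self_sub_floor] at h1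
    rw [← h1]
    exact hC (x, Int.fract t) ⟨hx, Int.fract_nonneg t, (Int.fract_lt_one t).le⟩
  refine ⟨2 * C, fun β h0 h1 θ η hθ hη => ?_⟩
  have hη' : IsAngle ⟨fun t => H (r.symm (β t).1, θ t), by
      have : Continuous fun t => r.symm (β t).1 :=
        r.symm.continuous.comp (continuous_fst.comp β.continuous)
      fun_prop⟩ (h.comp β) := by
    intro t
    refine (hHt _ _).trans ?_
    rw [r.apply_symm_apply, show turn (θ t) = (β t).2 from hθ t]; rfl
  rw [hη'.sub_eq hη]
  have b0 := hbound _ (mem_image_of_mem _ h0) (θ 0)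
  have b1 := hbound _ (mem_image_of_mem _ h1) (θ 1)
  simp only [Function.comp_apply, ContinuousMap.coe_mk] at b0 b1 ⊢
  rw [abs_le] at *
  constructor <;> linarith [b0.1, b0.2, b1.1, b1.2]

/-- If `f` is semiconjugate to `m_d`, then the `f^n`-lifts, with endpoints in a compact set, of
loops of class one cross `c` a bounded number of times. -/
theorem IsSemiconjugate.exists_abs_crossing_le {f : C(Annulus, Annulus)} {d : ℕ} (hd : 1 ≤ d)
    (hf : IsSemiconjugate f d) {K : Set Annulus} (hK : IsCompact K) (r : ℝ ≃ₜ Ioo (0 : ℝ) 1) :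
    ∃ C : ℝ, ∀ (n : ℕ) (α : C(UnitAddCircle, Annulus)) (β : C(unitInterval, Annulus)),
      homologyClass α = 1 → IsIterateLift f n 1 α β → β 0 ∈ K → β 1 ∈ K →
        |(crossing β : ℝ)| ≤ C := by
  obtain ⟨h, hh, hsemi⟩ := hf
  obtain ⟨C, hC⟩ := exists_abs_angle_sub_le h hh hK r
  -- Beyond `C`, one unit bounds the variation of the angle of `h`, and one the rounding by the two
  -- floors.
  refine ⟨C + 2, fun n α β hα hβ h0 h1 => ?_⟩
  set θ := angle (proj.comp β)
  set η := angle (h.comp β)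
  have hθ : IsAngle θ (proj.comp β) := isAngle_angle _
  have hη : IsAngle η (h.comp β) := isAngle_angle _
  have hiter : ∀ z : Circle, (powerMap d)^[n] z = z ^ d ^ n := by
    intro z
    clear hβ
    induction n with
    | zero => simp
    | succ n ih => rw [Function.iterate_succ_apply', ih, powerMap, pow_succ, pow_mul]
  -- Since `h f^n = m_d^n h`, multiplying the angle of `h ∘ β` by `d ^ n` gives an angle of `h ∘ α`,
  -- whose total variation is `1`.
  have hang : IsAngle ⟨fun t => ((d ^ n : ℕ) : ℝ) * η t, by fun_prop⟩ (loopPath (h.comp α)) := by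
    intro t
    change turn (((d ^ n : ℕ) : ℝ) * η t) = h (α ((t : ℝ) : UnitAddCircle))
    have h2 := hβ t
    rw [Nat.cast_one, one_mul] at h2
    rw [turn_natCast_mul, show turn (η t) = h (β t) from hη t, ← h2,
      (hsemi.iterate_right n) (β t), hiter]
  have h3 := loopDegree_eq _ hang
  rw [hh, hα, Int.cast_one] at h3
  simp only [ContinuousMap.coe_mk, ← mul_sub] at h3
  have h4 : (1 : ℝ) ≤ ((d ^ n : ℕ) : ℝ) := by exact_mod_cast Nat.one_le_pow _ _ hd
  have h5 : |η 1 - η 0| ≤ 1 := by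
    have h6 : |((d ^ n : ℕ) : ℝ)| * |η 1 - η 0| = 1 := by rw [← abs_mul, ← h3, abs_one]
    rw [abs_of_pos (by linarith)] at h6
    nlinarith [abs_nonneg (η 1 - η 0)]
  have h7 := hC β h0 h1 θ η hθ hη
  rw [crossing_eq β hθ, abs_le]
  rw [abs_le] at h5 h7
  push_cast
  have f0 := Int.floor_le (θ 0)
  have f0' := Int.lt_floor_add_one (θ 0)
  have f1 := Int.floor_le (θ 1)
  have f1' := Int.lt_floor_add_one (θ 1)
  constructor <;> linarith [h5.1, h5.2, h7.1, h7.2]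

/-! ### Lifts that cross `c` many times. -/

variable {a : ℤ → Ioo (0 : ℝ) 1} (ha : StrictMono a)
    (ha_bot : Tendsto (fun n => (a n : ℝ)) atBot (𝓝 0))
    (ha_top : Tendsto (fun n => (a n : ℝ)) atTop (𝓝 1))

theorem isCompact_subAnnulus (a : ℤ → Ioo (0 : ℝ) 1) (n : ℤ) : IsCompact (subAnnulus a n) := by
  have : subAnnulus a n = Icc (a n) (a (n + 1)) ×ˢ univ := by
    ext p; simp [subAnnulus]
  rw [this]
  refine IsCompact.prod ?_ isCompact_univ
  rw [Topology.IsEmbedding.subtypeVal.isCompact_iff]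
  convert isCompact_Icc (a := (a n : ℝ)) (b := a (n + 1))
  ext x
  constructor
  · rintro ⟨y, hy, rfl⟩; exact hy
  · intro hx
    exact ⟨⟨x, (a n).2.1.trans_le hx.1, hx.2.trans_lt (a (n + 1)).2.2⟩, hx, rfl⟩

theorem turn_ne_one_of_fract_pos {x : ℝ} (h0 : 0 < Int.fract x) : turn x ≠ 1 := fun h => by
  obtain ⟨m, rfl⟩ := turn_eq_one_iff.1 h
  simp at h0

/-- The circle through the middle of the `m`-th band has an arc above it in the band, which twists
around `m + 1` times `2 ^ m`. -/
theorem exists_band_lift (m : ℕ) : ∃ x : C(unitInterval, ℝ),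
    (∀ t, x t ∈ Icc (bandLow m) (bandLow m + 3 * bandThird m)) ∧
    twist (x 0) = 0 ∧ twist (x 1) = 1 / 2 - (m + 1) * 2 ^ m ∧
    ∀ t : unitInterval, modelMap (x t, turn (1 / 4 + t / 2 - twist (x t))) =
      (bandLow m + 3 / 2 * bandThird m + 1, turn (1 / 2 + t)) := by
  have hpos := bandThird_pos m
  set mid := bandLow m + 3 / 2 * bandThird m with hmid
  -- Half a turn from height `1` to height `-1`. As `push` is half a third at both ends of the
  -- middle third, the point sheared onto `mid` moves from one end to the other.
  let w : unitInterval → Circle := fun t => turn (1 / 4 + t / 2)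
  have hw : Continuous w := continuous_turn.comp (by fun_prop)
  let x : C(unitInterval, ℝ) := ⟨fun t => (bandShear.symm (mid, w t)).1,
    continuous_fst.comp (bandShear.symm.continuous.comp (continuous_const.prodMk hw))⟩
  have hx : ∀ t, bandShear.symm (mid, w t) = (x t, w t) := fun t => Prod.ext rfl rfl
  have hx' : ∀ t, bandShear (x t, w t) = (mid, w t) := fun t => by
    rw [← hx, Homeomorph.apply_symm_apply]
  have hfst : ∀ t, x t + push (x t) * (w t : ℂ).im = mid := fun t => congrArg Prod.fst (hx' t)
  have huniq : ∀ t y, y + push y * (w t : ℂ).im = mid → x t = y := fun t y hy =>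
    (strictMono_add_mul_of_lipschitz push_lipschitz (abs_im_le_one (w t))).injective
      ((hfst t).trans hy.symm)
  have hx0 : x 0 = bandLow m + bandThird m := by
    refine huniq 0 _ ?_
    have : (w 0 : ℂ).im = 1 := by
      simp only [w, im_turn, Icc.coe_zero]
      rw [show 2 * Real.pi * (1 / 4 + 0 / 2) = Real.pi / 2 by ring, Real.sin_pi_div_two]
    rw [this, push_left]; ring
  have hx1 : x 1 = bandLow m + 2 * bandThird m := by
    refine huniq 1 _ ?_
    have : (w 1 : ℂ).im = -1 := by
      simp only [w, im_turn, Icc.coe_one]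
      rw [show 2 * Real.pi * (1 / 4 + 1 / 2) = Real.pi / 2 + Real.pi by ring, Real.sin_add_pi,
        Real.sin_pi_div_two]
    rw [this, push_right]; ring
  refine ⟨x, fun t => ?_, by rw [hx0, twist_left], by rw [hx1, twist_right], fun t => ?_⟩
  · have hm := strictMono_add_mul_of_lipschitz push_lipschitz (abs_im_le_one (w t))
    have h1 := hm.le_iff_le (a := bandLow m) (b := x t)
    have h2 := hm.le_iff_le (a := x t) (b := bandLow m + 3 * bandThird m)
    simp only [hfst, push_eq_zero (bandLow_mem_offBand m), push_eq_zero (bandLow_add_mem_offBand m),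
      zero_mul, add_zero] at h1 h2
    exact ⟨h1.1 (by linarith), h2.1 (by linarith)⟩
  · rw [modelMap_apply]
    simp only
    rw [← turn_add, sub_add_cancel, ← turn_natCast_mul]
    refine Prod.ext (congrArg (· + 1) (hfst t)) ?_
    simp only
    congr 1; push_cast; ring

/-- The band arc is translated down by `m` into `A_0`, where `m` steps of the map bring it back
unperturbed, and the last step sends it to the circle. -/
theorem exists_lift_crossing (m : ℕ) :
    ∃ (α : C(UnitAddCircle, Annulus)) (β : C(unitInterval, Annulus)),
      Function.Injective α ∧ homologyClass α = 1 ∧ (∀ s, α s ∈ subAnnulus a (m + 1 : ℕ)) ∧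
      IsIterateLift (annulusMap ha ha_bot ha_top) (m + 1) 1 α β ∧
      (∀ t, β t ∈ subAnnulus a 0) ∧ CrossingDefined β ∧ crossing β = m + 1 := by
  have hpos := bandThird_pos m
  have hlow := natCast_lt_bandLow m
  have hhigh := bandLow_add_le m
  obtain ⟨x, hxmem, hx0, hx1, hmap⟩ := exists_band_lift m
  -- Dividing by `2 ^ m` inverts the angle multiplication of the first `m` steps. The angle starts
  -- at `1 / 4 / 2 ^ m`, strictly between `0` and `1`, and gains the integer `m + 1`, so both
  -- endpoints avoid `c`.
  let θ : C(unitInterval, ℝ) := ⟨fun t => (1 / 4 + t / 2 - twist (x t)) / 2 ^ m, by fun_prop⟩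
  have hθ0 : θ 0 = 1 / 4 / 2 ^ m := by simp [θ, hx0]
  have hθ1 : θ 1 = 1 / 4 / 2 ^ m + ((m + 1 : ℕ) : ℝ) := by
    simp only [θ, ContinuousMap.coe_mk, hx1, Icc.coe_one]
    field_simp
    push_cast; ring
  have hsmall : 1 / 4 / 2 ^ m ∈ Ioo (0 : ℝ) 1 := by
    refine ⟨by positivity, ?_⟩
    rw [div_lt_one (by positivity)]
    have : (1 : ℝ) ≤ 2 ^ m := one_le_pow₀ (by norm_num)
    linarith
  have hfl : ⌊(1 / 4 / 2 ^ m : ℝ)⌋ = 0 := Int.floor_eq_zero_iff.2 ⟨hsmall.1.le, hsmall.2⟩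
  have hfr : Int.fract (1 / 4 / 2 ^ m : ℝ) = 1 / 4 / 2 ^ m :=
    Int.fract_eq_self.2 ⟨hsmall.1.le, hsmall.2⟩
  let β : C(unitInterval, Annulus) := ⟨fun t => chart ha ha_bot ha_top (x t - m, turn (θ t)),
    (chart ha ha_bot ha_top).continuous.comp
      ((x.continuous.sub continuous_const).prodMk (continuous_turn.comp θ.continuous))⟩
  have hang : IsAngle θ (proj.comp β) := fun t => rfl
  -- The starting angle `1 / 2` is twice the initial angle `1 / 4` of the half turn, and the final
  -- squaring turns that half turn into one full circuit.
  refine ⟨circleLoop (radial ha ha_bot ha_top (bandLow m + 3 / 2 * bandThird m + 1))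
      (turn (1 / 2)), β, injective_circleLoop _ _, homologyClass_circleLoop _ _, fun s => ?_,
    fun t => ?_, fun t => ?_, Or.inl ⟨?_, ?_⟩, ?_⟩
  · refine (radial_mem_Icc_iff ha ha_bot ha_top _ _).2 ?_
    push_cast
    constructor <;> linarith
  · change (annulusMap ha ha_bot ha_top)^[m + 1] (chart ha ha_bot ha_top _) = _
    have hit := modelMap_iterate (m := m) (q := (x t - m, turn (θ t)))
      fun k hk => sub_add_mem_offBand hk (hxmem t)
    rw [← ((semiconj_chart ha ha_bot ha_top).iterate_right (m + 1)) _, Nat.cast_one, one_mul,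
      circleLoop_coe, Function.iterate_succ_apply', hit, ← turn_natCast_mul]
    simp only [θ, ContinuousMap.coe_mk, sub_add_cancel, Nat.cast_pow, Nat.cast_ofNat]
    rw [mul_div_cancel₀ _ (by positivity), hmap, chart_apply]
  · refine (chart_mem_subAnnulus_iff ha ha_bot ha_top 0 _).2 ?_
    have := hxmem t
    simp only [Int.cast_zero, zero_add]
    constructor <;> linarith [this.1, this.2]
  · exact turn_ne_one_of_fract_pos (by rw [hθ0, hfr]; exact hsmall.1)
  · exact turn_ne_one_of_fract_pos (by rw [hθ1, Int.fract_add_natCast, hfr]; exact hsmall.1)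
  · rw [crossing_eq β hang, hθ0, hθ1, Int.floor_add_natCast, hfl]
    push_cast; ring

theorem not_conditionStar_annulusMap : ¬ ConditionStar (annulusMap ha ha_bot ha_top) 2 := by
  intro h
  obtain ⟨C, hC⟩ := h _ (isCompact_subAnnulus a 0)
  obtain ⟨m, hm⟩ := exists_nat_gt C
  obtain ⟨α, β, hα, -, -, hlift, hβ, hdef, hcross⟩ := exists_lift_crossing ha ha_bot ha_top m
  have := hC α hα (m + 1) (by omega) 1 le_rfl Nat.one_le_two_pow β hlift (hβ 0) (hβ 1) hdef
  rw [hcross] at this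
  push_cast at this
  linarith [le_abs_self ((m : ℝ) + 1)]

theorem not_isSemiconjugate_annulusMap :
    ¬ IsSemiconjugate (annulusMap ha ha_bot ha_top) 2 := by
  intro h
  obtain ⟨C, hC⟩ := h.exists_abs_crossing_le one_le_two (isCompact_subAnnulus a 0)
    (radial ha ha_bot ha_top).toHomeomorph
  obtain ⟨m, hm⟩ := exists_nat_gt C
  obtain ⟨α, β, -, hα, -, hlift, hβ, -, hcross⟩ := exists_lift_crossing ha ha_bot ha_top m
  have := hC (m + 1) α β hα hlift (hβ 0) (hβ 1)
  rw [hcross] at this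
  push_cast at this
  linarith [le_abs_self ((m : ℝ) + 1)]

end

end AnnulusCovering

end

theorem mainTheorem5 (a : ℤ → Set.Ioo (0 : ℝ) 1) (ha : StrictMono a)
    (ha_bot : Filter.Tendsto (fun n => (a n : ℝ)) Filter.atBot (nhds 0))
    (ha_top : Filter.Tendsto (fun n => (a n : ℝ)) Filter.atTop (nhds 1)) :
    ∃ f : C(AnnulusCovering.Annulus, AnnulusCovering.Annulus),
      -- `f` is a covering map of degree 2 (with two sheets, and of homological degree 2)
      IsCoveringMap f ∧
      (∀ y, (f ⁻¹' {y}).ncard = 2) ∧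
      AnnulusCovering.HasDegree f 2 ∧
      -- `f` covers `A_{n+1}` by `A_n`, is `(a_n, z) ↦ (a_{n+1}, z²)` on the boundary circles,
      -- and is affine in the radius and `z ↦ z²` in the angle on `A_n` for `n ≤ -1`
      (∀ n : ℤ, f ⁻¹' AnnulusCovering.subAnnulus a (n + 1) = AnnulusCovering.subAnnulus a n) ∧
      (∀ (n : ℤ) (z : Circle), f (a n, z) = (a (n + 1), z ^ 2)) ∧
      (∀ n : ℤ, n ≤ -1 → ∀ p ∈ AnnulusCovering.subAnnulus a n,
        ((f p).1 : ℝ) = a (n + 1) +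
          (a (n + 2) - a (n + 1) : ℝ) * ((p.1 - a n : ℝ) / (a (n + 1) - a n : ℝ)) ∧
        (f p).2 = p.2 ^ 2) ∧
      -- for every `n ≥ 1` some `f^n`-lift, in `A_0`, of an iterate `jα` of a simple closed
      -- curve `α` in `A_n` has intersection number with `c` larger than `n - 1`
      (∀ n : ℕ, 1 ≤ n →
        ∃ (α : C(UnitAddCircle, AnnulusCovering.Annulus)) (j : ℕ)
          (β : C(unitInterval, AnnulusCovering.Annulus)),
          Function.Injective α ∧ (∀ s, α s ∈ AnnulusCovering.subAnnulus a n) ∧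
          1 ≤ j ∧ j ≤ 2 ^ (n - 1) ∧
          AnnulusCovering.IsIterateLift f n j α β ∧
          (∀ t, β t ∈ AnnulusCovering.subAnnulus a 0) ∧
          AnnulusCovering.CrossingDefined β ∧
          (n : ℝ) - 1 < |(AnnulusCovering.crossing β : ℝ)|) ∧
      -- condition (*) fails, and `f` is not semiconjugate to `m_2`
      ¬ AnnulusCovering.ConditionStar f 2 ∧
      ¬ AnnulusCovering.IsSemiconjugate f 2 := by
  obtain ⟨f, hf⟩ : ∃ f, f = AnnulusCovering.annulusMap ha ha_bot ha_top := ⟨_, rfl⟩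
  refine ⟨f, ?_, ?_, ?_, ?_, ?_, ?_, ?_, ?_, ?_⟩ <;> subst hf
  · exact AnnulusCovering.isCoveringMap_annulusMap ha ha_bot ha_top
  · exact AnnulusCovering.ncard_preimage_annulusMap ha ha_bot ha_top
  · exact AnnulusCovering.hasDegree_annulusMap ha ha_bot ha_top
  · exact AnnulusCovering.preimage_subAnnulus ha ha_bot ha_top
  · exact AnnulusCovering.annulusMap_boundary ha ha_bot ha_top
  · exact fun n hn p hp => AnnulusCovering.annulusMap_affine ha ha_bot ha_top hn hp
  · intro n hn
    obtain ⟨m, rfl⟩ : ∃ m, n = m + 1 := ⟨n - 1, by omega⟩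
    obtain ⟨α, β, hα, -, hαmem, hlift, hβ, hdef, hcross⟩ :=
      AnnulusCovering.exists_lift_crossing ha ha_bot ha_top m
    refine ⟨α, 1, β, hα, hαmem, le_rfl, Nat.one_le_two_pow, hlift, hβ, hdef, ?_⟩
    rw [hcross]
    push_cast
    linarith [le_abs_self ((m : ℝ) + 1)]
  · exact AnnulusCovering.not_conditionStar_annulusMap ha ha_bot ha_top
  · exact AnnulusCovering.not_isSemiconjugate_annulusMap ha ha_bot ha_top
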